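/- Let Boolean PCF with Boolean references be the call-by-value language defined as follows. Types are $\tau ::= \mathtt{unit}\mid\mathtt{bool}\mid\tau_1\to\tau_2\mid\mathtt{ref}\,\mathtt{bool}$, where $\mathtt{unit}$ and $\mathtt{bool}$ are the base types. Expressions (up to renaming of bound variables) are $$M ::= \mathtt{fail}\mid ()\mid \mathtt{true}\mid\mathtt{false}\mid x\mid \lambda x.M\mid M_1M_2\mid Y(\lambda f.\lambda x.M)\mid \mathtt{if}\ M_0\ \mathtt{then}\ M_1\ \mathtt{else}\ M_2\mid \mathtt{ref}\,M\mid\, !M\mid M_1:=M_2 .$$ The typing judgment $\Gamma\vdash M:\tau$ is given by the rules of the simply typed $\lambda$-calculus for variables, abstraction and application, the usual rules for constants and conditionals (both branches of the same type), and: $\Gamma\vdash\mathtt{fail}:\tau$ for every $\tau$; $\Gamma\vdash Y(\lambda f.\lambda x.M):\tau_1\to\tau_2$ if $\Gamma,f:\tau_1\to\tau_2,x:\tau_1\vdash M:\tau_2$; $\Gamma\vdash\mathtt{ref}\,M:\mathtt{ref}\,\mathtt{bool}$ if $\Gamma\vdash M:\mathtt{bool}$; $\Gamma\vdash\, !M:\mathtt{bool}$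 if $\Gamma\vdash M:\mathtt{ref}\,\mathtt{bool}$; and $\Gamma\vdash M_1:=M_2:\mathtt{unit}$ if $\Gamma\vdash M_1:\mathtt{ref}\,\mathtt{bool}$ and $\Gamma\vdash M_2:\mathtt{bool}$. At run time expressions may also contain store locations $\ell$. Values $V$ are $()$, $\mathtt{true}$, $\mathtt{false}$, $\lambda x.M$ and $\ell$; a store $\mu$ is a finite map from locations to Booleans; evaluation contexts are $$E ::= [\,]\mid E\,M\mid V\,E\mid \mathtt{if}\ E\ \mathtt{then}\ M_1\ \mathtt{else}\ M_2\mid \mathtt{ref}\,E\mid\, !E\mid E:=M\mid \ell:=E .$$ Reduction on pairs of an expression and a store is given by $$\begin{aligned} (E[(\lambda x.M)V],\mu)&\to(E[[V/x]M],\mu),\\ (E[\mathtt{if}\ \mathtt{true}\ \mathtt{then}\ M_1\ \mathtt{else}\ M_2],\mu)&\to(E[M_1],\mu),\\ (E[\mathtt{if}\ \mathtt{false}\ \mathtt{then}\ M_1\ \mathtt{else}\ M_2],\mu)&\to(E[M_2],\mu),\\ (E[Y(\lambda f.\lambda x.M)],\mu)&\to(E[\lambda x.[Y(\lambda f.\lambda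 x.M)/f]M],\mu),\\ (E[\mathtt{fail}],\mu)&\to(\mathtt{fail},\mu),\\ (E[\mathtt{ref}\,b],\mu)&\to(E[\ell],\mu\cup\{\ell\mapsto b\})\quad\text{with }\ell\text{ fresh},\\ (E[\,!\ell],\mu)&\to(E[\mu(\ell)],\mu)\quad\text{if }\ell\in\mathrm{dom}(\mu),\\ (E[\ell:=b],\mu)&\to(E[()],\mu[\ell\mapsto b])\quad\text{if }\ell\in\mathrm{dom}(\mu), \end{aligned}$$ where $b\in\{\mathtt{true},\mathtt{false}\}$. Write $M\to^*\mathtt{fail}$ if $(M,\emptyset)$ reduces in zero or more steps to $(\mathtt{fail},\mu)$ for some store $\mu$. **Theorem.** The reachability problem for Boolean PCF with Boolean references is undecidable: there is no algorithm that, given a closed expression $M$ with $\vdash M:\beta$ for a base type $\beta$, halts and correctly decides whether $M\to^*\mathtt{fail}$ (even if nothing is required of the algorithm on other inputs). -/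

import Mathlib

namespace BPCFR

/-- Base types: `unit` and `bool`. -/
inductive BaseTy : Type
  | unit
  | bool

/-- Types: base types, function types, and the type of references to Booleans. -/
inductive Ty : Type
  | base (b : BaseTy)
  | fn (τ₁ τ₂ : Ty)
  | refBool

/-- Expressions, up to renaming of bound variables (de Bruijn indices).
`lam M` is `λ x. M` with `x` the variable `0` of `M`.
`fix M` is `Y (λ f. λ x. M)` with `x` the variable `0` and `f` the variable `1` of `M`.
`loc l` is a store location; it has no typing rule, so it arises only at run time. -/
inductive Term : Type
  | fail
  | unit
  | tt
  | ff
  | var (i : ℕ)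
  | loc (l : ℕ)
  | lam (M : Term)
  | app (M₁ M₂ : Term)
  | fix (M : Term)
  | ite (M₀ M₁ M₂ : Term)
  | mkref (M : Term)
  | deref (M : Term)
  | assign (M₁ M₂ : Term)

/-- The typing judgment `Γ ⊢ M : τ`; `Γ` lists the types of the variables `0, 1, …`. -/
inductive HasType : List Ty → Term → Ty → Prop
  | fail {Γ : List Ty} {τ : Ty} : HasType Γ Term.fail τ
  | unit {Γ : List Ty} : HasType Γ Term.unit (Ty.base BaseTy.unit)
  | tt {Γ : List Ty} : HasType Γ Term.tt (Ty.base BaseTy.bool)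
  | ff {Γ : List Ty} : HasType Γ Term.ff (Ty.base BaseTy.bool)
  | var {Γ : List Ty} {i : ℕ} {τ : Ty} : Γ[i]? = some τ → HasType Γ (Term.var i) τ
  | lam {Γ : List Ty} {M : Term} {τ₁ τ₂ : Ty} :
      HasType (τ₁ :: Γ) M τ₂ → HasType Γ (Term.lam M) (Ty.fn τ₁ τ₂)
  | app {Γ : List Ty} {M₁ M₂ : Term} {τ₁ τ₂ : Ty} :
      HasType Γ M₁ (Ty.fn τ₁ τ₂) → HasType Γ M₂ τ₁ → HasType Γ (Term.app M₁ M₂) τ₂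
  | fix {Γ : List Ty} {M : Term} {τ₁ τ₂ : Ty} :
      HasType (τ₁ :: Ty.fn τ₁ τ₂ :: Γ) M τ₂ → HasType Γ (Term.fix M) (Ty.fn τ₁ τ₂)
  | ite {Γ : List Ty} {M₀ M₁ M₂ : Term} {τ : Ty} :
      HasType Γ M₀ (Ty.base BaseTy.bool) → HasType Γ M₁ τ → HasType Γ M₂ τ →
      HasType Γ (Term.ite M₀ M₁ M₂) τ
  | mkref {Γ : List Ty} {M : Term} :
      HasType Γ M (Ty.base BaseTy.bool) → HasType Γ (Term.mkref M) Ty.refBool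
  | deref {Γ : List Ty} {M : Term} :
      HasType Γ M Ty.refBool → HasType Γ (Term.deref M) (Ty.base BaseTy.bool)
  | assign {Γ : List Ty} {M₁ M₂ : Term} :
      HasType Γ M₁ Ty.refBool → HasType Γ M₂ (Ty.base BaseTy.bool) →
      HasType Γ (Term.assign M₁ M₂) (Ty.base BaseTy.unit)

namespace Term

/-- Lift a renaming under one binder. -/
def upRen (ρ : ℕ → ℕ) : ℕ → ℕ
  | 0 => 0
  | i + 1 => ρ i + 1

/-- Simultaneous renaming of variables. -/
def rename : (ℕ → ℕ) → Term → Term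
  | _, fail => fail
  | _, unit => unit
  | _, tt => tt
  | _, ff => ff
  | ρ, var i => var (ρ i)
  | _, loc l => loc l
  | ρ, lam M => lam (rename (upRen ρ) M)
  | ρ, app M₁ M₂ => app (rename ρ M₁) (rename ρ M₂)
  | ρ, fix M => fix (rename (upRen (upRen ρ)) M)
  | ρ, ite M₀ M₁ M₂ => ite (rename ρ M₀) (rename ρ M₁) (rename ρ M₂)
  | ρ, mkref M => mkref (rename ρ M)
  | ρ, deref M => deref (rename ρ M)
  | ρ, assign M₁ M₂ => assign (rename ρ M₁) (rename ρ M₂)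

/-- Lift a substitution under one binder. -/
def upSubst (s : ℕ → Term) : ℕ → Term
  | 0 => var 0
  | i + 1 => rename Nat.succ (s i)

/-- Simultaneous capture-avoiding substitution. -/
def subst : (ℕ → Term) → Term → Term
  | _, fail => fail
  | _, unit => unit
  | _, tt => tt
  | _, ff => ff
  | s, var i => s i
  | _, loc l => loc l
  | s, lam M => lam (subst (upSubst s) M)
  | s, app M₁ M₂ => app (subst s M₁) (subst s M₂)
  | s, fix M => fix (subst (upSubst (upSubst s)) M)
  | s, ite M₀ M₁ M₂ => ite (subst s M₀) (subst s M₁) (subst s M₂)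
  | s, mkref M => mkref (subst s M)
  | s, deref M => deref (subst s M)
  | s, assign M₁ M₂ => assign (subst s M₁) (subst s M₂)

/-- The substitution sending variable `0` to `N` and variable `i + 1` to variable `i`. -/
def single (N : Term) : ℕ → Term
  | 0 => N
  | i + 1 => var i

/-- `[N/x] M`, where `x` is the variable `0` of `M`. -/
def inst (M N : Term) : Term := subst (single N) M

/-- The expression denoting a Boolean constant. -/
def ofBool : Bool → Term
  | true => tt
  | false => ff

/-- Values: unit, the Boolean constants, abstractions and (at run time) locations. -/
inductive IsValue : Term → Prop
  | unit : IsValue unit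
  | tt : IsValue tt
  | ff : IsValue ff
  | lam (M : Term) : IsValue (lam M)
  | loc (l : ℕ) : IsValue (loc l)

end Term

/-- Call-by-value evaluation contexts
`E ::= [] | E M | V E | if E then M₁ else M₂ | ref E | !E | E := M | ℓ := E`. -/
inductive Ctx : Type
  | hole
  | appL (E : Ctx) (M : Term)
  | appR (V : Term) (hV : V.IsValue) (E : Ctx)
  | ite (E : Ctx) (M₁ M₂ : Term)
  | mkref (E : Ctx)
  | deref (E : Ctx)
  | assignL (E : Ctx) (M : Term)
  | assignR (l : ℕ) (E : Ctx)

/-- `E.fill M` is `E[M]`. -/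
def Ctx.fill : Ctx → Term → Term
  | hole, N => N
  | appL E M, N => Term.app (E.fill N) M
  | appR V _ E, N => Term.app V (E.fill N)
  | ite E M₁ M₂, N => Term.ite (E.fill N) M₁ M₂
  | mkref E, N => Term.mkref (E.fill N)
  | deref E, N => Term.deref (E.fill N)
  | assignL E M, N => Term.assign (E.fill N) M
  | assignR l E, N => Term.assign (Term.loc l) (E.fill N)

/-- A store: the `l`-th entry is the content of location `l`,
and the allocated locations are those below the length. -/
abbrev Store : Type := List Bool

/-- The one-step call-by-value reduction on pairs of an expression and a store. -/
inductive Step : Term × Store → Term × Store → Prop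
  | beta (E : Ctx) (M V : Term) (μ : Store) : V.IsValue →
      Step (E.fill (Term.app (Term.lam M) V), μ) (E.fill (M.inst V), μ)
  | iteTrue (E : Ctx) (M₁ M₂ : Term) (μ : Store) :
      Step (E.fill (Term.ite Term.tt M₁ M₂), μ) (E.fill M₁, μ)
  | iteFalse (E : Ctx) (M₁ M₂ : Term) (μ : Store) :
      Step (E.fill (Term.ite Term.ff M₁ M₂), μ) (E.fill M₂, μ)
  | fail (E : Ctx) (μ : Store) : Step (E.fill Term.fail, μ) (Term.fail, μ)
  /- `Y (λ f. λ x. M)` steps to `λ x. [Y (λ f. λ x. M) / f] M` -/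
  | fix (E : Ctx) (M : Term) (μ : Store) :
      Step (E.fill (Term.fix M), μ)
        (E.fill (Term.lam (M.subst (Term.upSubst (Term.single (Term.fix M))))), μ)
  /- allocation of a fresh location, initialized with `b` -/
  | mkref (E : Ctx) (b : Bool) (μ : Store) :
      Step (E.fill (Term.mkref (Term.ofBool b)), μ) (E.fill (Term.loc μ.length), μ ++ [b])
  | deref (E : Ctx) (l : ℕ) (b : Bool) (μ : Store) : μ[l]? = some b →
      Step (E.fill (Term.deref (Term.loc l)), μ) (E.fill (Term.ofBool b), μ)
  | assign (E : Ctx) (l : ℕ) (b : Bool) (μ : Store) : l < μ.length →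
      Step (E.fill (Term.assign (Term.loc l) (Term.ofBool b)), μ)
        (E.fill Term.unit, μ.set l b)

/-- `M` reduces, from the empty store, to `FAIL` in zero or more steps. -/
def Reaches (M : Term) : Prop :=
  ∃ μ : Store, Relation.ReflTransGen Step (M, []) (Term.fail, μ)

/-- The instances of the reachability problem: closed expressions of some base type. -/
def IsInstance (M : Term) : Prop := ∃ b : BaseTy, HasType [] M (Ty.base b)

namespace Term

/-- An explicit Gödel numbering of expressions. -/
def code : Term → ℕ
  | fail => 0
  | unit => 1
  | tt => 2
  | ff => 3
  | var i => 9 * i + 4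
  | loc l => 9 * l + 5
  | lam M => 9 * M.code + 6
  | app M₁ M₂ => 9 * Nat.pair M₁.code M₂.code + 7
  | fix M => 9 * M.code + 8
  | ite M₀ M₁ M₂ => 9 * Nat.pair M₀.code (Nat.pair M₁.code M₂.code) + 9
  | mkref M => 9 * M.code + 10
  | deref M => 9 * M.code + 11
  | assign M₁ M₂ => 9 * Nat.pair M₁.code M₂.code + 12

/-- The inverse of the numbering `code`. -/
def ofCode : ℕ → Term
  | 0 => fail
  | 1 => unit
  | 2 => tt
  | 3 => ff
  | n + 4 =>
    let m := n / 9
    have hm : m < n + 4 := lt_of_le_of_lt (Nat.div_le_self n 9) (by omega)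
    have h1 : m.unpair.1 < n + 4 := lt_of_le_of_lt m.unpair_left_le hm
    have h2 : m.unpair.2 < n + 4 := lt_of_le_of_lt m.unpair_right_le hm
    have h3 : m.unpair.2.unpair.1 < n + 4 := lt_of_le_of_lt m.unpair.2.unpair_left_le h2
    have h4 : m.unpair.2.unpair.2 < n + 4 := lt_of_le_of_lt m.unpair.2.unpair_right_le h2
    match n % 9 with
    | 0 => var m
    | 1 => loc m
    | 2 => lam (ofCode m)
    | 3 => app (ofCode m.unpair.1) (ofCode m.unpair.2)
    | 4 => fix (ofCode m)
    | 5 => ite (ofCode m.unpair.1) (ofCode m.unpair.2.unpair.1) (ofCode m.unpair.2.unpair.2)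
    | 6 => mkref (ofCode m)
    | 7 => deref (ofCode m)
    | _ => assign (ofCode m.unpair.1) (ofCode m.unpair.2)
termination_by n => n
decreasing_by
  all_goals first
    | exact hm
    | exact h1
    | exact h2
    | exact h3
    | exact h4

theorem ofCode_code (M : Term) : ofCode M.code = M := by
  have hdiv : ∀ a r : ℕ, r < 9 → (9 * a + r) / 9 = a := fun a r h => by omega
  have hmod : ∀ a r : ℕ, r < 9 → (9 * a + r) % 9 = r := fun a r h => by omega
  have key : ∀ a r : ℕ, 9 * a + (r + 4) = (9 * a + r) + 4 := fun a r => by omega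
  induction M with
  | fail => simp [code, ofCode]
  | unit => simp [code, ofCode]
  | tt => simp [code, ofCode]
  | ff => simp [code, ofCode]
  | var i => rw [code, key i 0, ofCode]; simp [hdiv, hmod]
  | loc i => rw [code, key i 1, ofCode]; simp [hdiv, hmod]
  | lam M ih => rw [code, key _ 2, ofCode]; simp [hdiv, hmod, ih]
  | app M N ih₁ ih₂ => rw [code, key _ 3, ofCode]; simp [hdiv, hmod, ih₁, ih₂]
  | fix M ih => rw [code, key _ 4, ofCode]; simp [hdiv, hmod, ih]
  | ite L M N ih₀ ih₁ ih₂ => rw [code, key _ 5, ofCode]; simp [hdiv, hmod, ih₀, ih₁, ih₂]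
  | mkref M ih => rw [code, key _ 6, ofCode]; simp [hdiv, hmod, ih]
  | deref M ih => rw [code, key _ 7, ofCode]; simp [hdiv, hmod, ih]
  | assign M N ih₁ ih₂ => rw [code, key _ 8, ofCode]; simp [hdiv, hmod, ih₁, ih₂]

theorem code_ofCode (n : ℕ) : (ofCode n).code = n := by
  induction n using Nat.strong_induction_on with
  | _ n ih =>
    match n, ih with
    | 0, _ => simp [ofCode, code]
    | 1, _ => simp [ofCode, code]
    | 2, _ => simp [ofCode, code]
    | 3, _ => simp [ofCode, code]
    | n + 4, ih =>
      have hm : n / 9 < n + 4 := lt_of_le_of_lt (Nat.div_le_self n 9) (by omega)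
      have h1 := lt_of_le_of_lt (n / 9).unpair_left_le hm
      have h2 := lt_of_le_of_lt (n / 9).unpair_right_le hm
      have h3 := lt_of_le_of_lt (n / 9).unpair.2.unpair_left_le h2
      have h4 := lt_of_le_of_lt (n / 9).unpair.2.unpair_right_le h2
      rw [ofCode]
      have hr : n % 9 < 9 := Nat.mod_lt _ (by norm_num)
      have hn : 9 * (n / 9) + n % 9 = n := Nat.div_add_mod n 9
      generalize n % 9 = r at hr hn
      interval_cases r <;>
        simp only [code, ih _ hm, ih _ h1, ih _ h2, ih _ h3, ih _ h4, Nat.pair_unpair] <;> omega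

/-- The numbering as a bijection with the natural numbers; it determines what it means for a
function on expressions to be computable. -/
instance instDenumerable : Denumerable Term :=
  Denumerable.mk' ⟨code, ofCode, ofCode_code, code_ofCode⟩

end Term

/-- The reachability problem is decidable: some algorithm halts with the correct answer on every
instance of the problem (nothing is required of it on other inputs). -/
def ReachabilityDecidable : Prop :=
  ∃ f : Term →. Bool, Partrec f ∧
    ∀ M : Term, IsInstance M → ∃ a ∈ f M, (a = true ↔ Reaches M)

end BPCFR

/-! Finitely many Boolean cells hold only finite information, but closures can own unboundedly many.
A natural number is represented by a procedure of type `Num` that owns a list of cells, its content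
being how many hold `true`. Applied to `ff` it clears one such cell, applied to `tt` it sets a
cleared one, and it reports whether there was a cell to change. This gives decrement with zero test,
and increment up to the number of cells; a true successor allocates one more cell in front
(`succBody`).

Cells are shared state, so a computation must leave its arguments with their contents and return a
counter that shares no cell with them. The key device is `loopBody`: a recursion decrements a
counter to zero on the way down and increments it again on the way back, never exceeding its
capacity. This copies counters (`Implementable.proj`) and performs primitive recursion
(`Implementable.prec`); minimization is a plain recursive search (`Implementable.rfind`). Hence
every partial recursive function is implemented by a typed term.

Applied to `n ↦ eval (code n) n`, this yields closed terms of type `unit` that reach `fail` when the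
value is `0` and evaluate to `()` when it is positive. A decision procedure for reachability would
itself have a code, and running that code on itself contradicts its answer. -/

namespace BPCFR

/-! ### Substitution calculus. -/

namespace Term

/-- Extend an environment by a value for the variable `0`. -/
def scons (V : Term) (s : ℕ → Term) : ℕ → Term
  | 0 => V
  | i + 1 => s i

@[simp] theorem scons_zero (V : Term) (s : ℕ → Term) : scons V s 0 = V := rfl

@[simp] theorem scons_succ (V : Term) (s : ℕ → Term) (i : ℕ) : scons V s (i + 1) = s i := rfl

theorem upRen_comp (ρ ρ' : ℕ → ℕ) : upRen ρ' ∘ upRen ρ = upRen (ρ' ∘ ρ) := by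
  funext i; cases i <;> rfl

theorem rename_rename (M : Term) (ρ ρ' : ℕ → ℕ) :
    (M.rename ρ).rename ρ' = M.rename (ρ' ∘ ρ) := by
  induction M generalizing ρ ρ' <;> simp_all [rename, upRen_comp]

theorem upSubst_upRen (ρ : ℕ → ℕ) (t : ℕ → Term) : upSubst t ∘ upRen ρ = upSubst (t ∘ ρ) := by
  funext i; cases i <;> rfl

theorem subst_rename (M : Term) (ρ : ℕ → ℕ) (t : ℕ → Term) :
    (M.rename ρ).subst t = M.subst (t ∘ ρ) := by
  induction M generalizing ρ t <;> simp_all [rename, subst, upSubst_upRen]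

theorem rename_upSubst (s : ℕ → Term) (ρ : ℕ → ℕ) :
    rename (upRen ρ) ∘ upSubst s = upSubst (rename ρ ∘ s) := by
  funext i
  cases i with
  | zero => rfl
  | succ i => simp only [Function.comp, upSubst, rename_rename]; rfl

theorem rename_subst (M : Term) (s : ℕ → Term) (ρ : ℕ → ℕ) :
    (M.subst s).rename ρ = M.subst (rename ρ ∘ s) := by
  induction M generalizing ρ s <;> simp_all [rename, subst, rename_upSubst]

theorem subst_upSubst (s t : ℕ → Term) :
    subst (upSubst t) ∘ upSubst s = upSubst (subst t ∘ s) := by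
  funext i
  cases i with
  | zero => rfl
  | succ i => simp only [Function.comp, upSubst, subst_rename, rename_subst]; rfl

theorem subst_subst (M : Term) (s t : ℕ → Term) :
    (M.subst s).subst t = M.subst (subst t ∘ s) := by
  induction M generalizing s t <;> simp_all [subst, subst_upSubst]

theorem upSubst_var : upSubst var = var := by
  funext i; cases i <;> rfl

theorem subst_var (M : Term) : M.subst var = M := by
  induction M <;> simp_all [subst, upSubst_var]

theorem subst_single_comp_upSubst (s : ℕ → Term) (V : Term) :
    subst (single V) ∘ upSubst s = scons V s := by
  funext i
  cases i with
  | zero => rfl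
  | succ i => exact (subst_rename _ _ _).trans (subst_var _)

/-- Lets a beta step be read as extending an environment, so that terms under evaluation keep the
form `M.subst s`. -/
theorem inst_subst_upSubst (M : Term) (s : ℕ → Term) (V : Term) :
    (M.subst (upSubst s)).inst V = M.subst (scons V s) := by
  rw [inst, subst_subst, subst_single_comp_upSubst]

theorem subst_upSubst_single (M : Term) (s : ℕ → Term) (V : Term) :
    (M.subst (upSubst (upSubst s))).subst (upSubst (single V)) =
      M.subst (upSubst (scons V s)) := by
  rw [subst_subst, subst_upSubst, subst_single_comp_upSubst]

end Term

open Term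

/-! ### Determinism -/

/-- The one-step reduction as a function: the result `some (none, μ)` stands for a failure. -/
def next : Term → Store → Option (Option Term × Store)
  | .fail, μ => some (none, μ)
  | .app A B, μ =>
    match next A μ with
    | some (r, μ') => some (r.map (.app · B), μ')
    | none => match next B μ with
      | some (r, μ') => some (r.map (.app A ·), μ')
      | none => match A with
        | .lam M => some (some (M.inst B), μ)
        | _ => none
  | .fix M, μ => some (some (.lam (M.subst (upSubst (single (.fix M))))), μ)
  | .ite A M N, μ =>
    match next A μ with
    | some (r, μ') => some (r.map (.ite · M N), μ')
    | none => match A with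
      | .tt => some (some M, μ)
      | .ff => some (some N, μ)
      | _ => none
  | .mkref A, μ =>
    match next A μ with
    | some (r, μ') => some (r.map .mkref, μ')
    | none => match A with
      | .tt => some (some (.loc μ.length), μ ++ [true])
      | .ff => some (some (.loc μ.length), μ ++ [false])
      | _ => none
  | .deref A, μ =>
    match next A μ with
    | some (r, μ') => some (r.map .deref, μ')
    | none => match A with
      | .loc l => (μ[l]?).map fun b => (some (ofBool b), μ)
      | _ => none
  | .assign A B, μ =>
    match next A μ with
    | some (r, μ') => some (r.map (.assign · B), μ')
    | none => match next B μ with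
      | some (r, μ') => some (r.map (.assign A ·), μ')
      | none => match A, B with
        | .loc l, .tt => some (some .unit, μ.set l true)
        | .loc l, .ff => some (some .unit, μ.set l false)
        | _, _ => none
  | _, _ => none

theorem next_of_isValue {V : Term} (h : V.IsValue) (μ : Store) : next V μ = none := by
  cases h <;> simp [next]

/-- Failure discards the context while any other step keeps it; coding failure as `none` lets `r.map
E.fill` cover both. -/
theorem next_fill (E : Ctx) {M : Term} {μ μ' : Store} {r : Option Term}
    (h : next M μ = some (r, μ')) : next (E.fill M) μ = some (r.map E.fill, μ') := by
  induction E with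
  | hole => rw [show Ctx.hole.fill = id from rfl]; simpa using h
  | appR V hV E ih =>
    simp only [Ctx.fill, next, ih, next_of_isValue hV, Option.map_map]; rfl
  | _ => simp_all only [Ctx.fill, next, Option.map_map]; rfl

/-- `next` omits some side conditions and so fires more often than `Step`; for determinism this
inclusion suffices. -/
theorem next_of_step {a b : Term × Store} (h : Step a b) :
    ∃ r : Option Term, next a.1 a.2 = some (r, b.2) ∧ r.getD Term.fail = b.1 := by
  cases h with
  | beta E M V μ hV =>
    exact ⟨_, next_fill E (r := some (M.inst V)) (μ' := μ) (by
      simp [next, next_of_isValue hV]), rfl⟩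
  | iteTrue E M N μ => exact ⟨_, next_fill E (r := some M) (μ' := μ) (by simp [next]), rfl⟩
  | iteFalse E M N μ => exact ⟨_, next_fill E (r := some N) (μ' := μ) (by simp [next]), rfl⟩
  | fail E μ => exact ⟨_, next_fill E (r := none) (μ' := μ) (by simp [next]), rfl⟩
  | fix E M μ => exact ⟨_, next_fill E (r := some _) (μ' := μ) (by simp only [next]), rfl⟩
  | mkref E b μ =>
    exact ⟨_, next_fill E (r := some (.loc μ.length)) (μ' := μ ++ [b]) (by
      cases b <;> simp [next, ofBool]), rfl⟩
  | deref E l b μ hl =>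
    exact ⟨_, next_fill E (r := some (ofBool b)) (μ' := μ) (by simp [next, hl]), rfl⟩
  | assign E l b μ hl =>
    exact ⟨_, next_fill E (r := some .unit) (μ' := μ.set l b) (by
      cases b <;> simp [next, ofBool]), rfl⟩

theorem Step.deterministic {a b c : Term × Store} (hb : Step a b) (hc : Step a c) : b = c := by
  obtain ⟨r, h1, h2⟩ := next_of_step hb
  obtain ⟨r', h1', h2'⟩ := next_of_step hc
  have h := Option.some.inj (h1.symm.trans h1')
  have hr : r = r' := congrArg (fun p => p.1) h
  have hμ : b.2 = c.2 := congrArg (fun p => p.2) h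
  exact Prod.ext (h2.symm.trans (hr ▸ h2')) hμ

/-- An expression that evaluates to `()` does not reach `FAIL`. -/
theorem not_reaches_of_unit {M : Term} {μ : Store}
    (h : Relation.ReflTransGen Step (M, []) (Term.unit, μ)) : ¬ Reaches M := by
  rintro ⟨μ', h'⟩
  have hunit : ∀ c, Relation.ReflTransGen Step (Term.unit, μ) c → c = (Term.unit, μ) := by
    intro c hc
    induction hc with
    | refl => rfl
    | tail _ hs ih =>
      subst ih
      obtain ⟨r, hr, -⟩ := next_of_step hs
      simp [next] at hr
  -- `fail` is not irreducible: it steps to itself in the empty context.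
  have hfail : ∀ c, Relation.ReflTransGen Step (Term.fail, μ') c → c.1 = Term.fail := by
    intro c hc
    induction hc with
    | refl => rfl
    | @tail b c _ hs ih =>
      obtain ⟨r, hr, hc⟩ := next_of_step hs
      rw [ih] at hr
      simp only [next, Option.some.injEq, Prod.mk.injEq] at hr
      rw [← hc, ← hr.1]; rfl
  rcases Relation.ReflTransGen.total_of_right_unique
    (r := Step) (fun _ _ _ h₁ h₂ => h₁.deterministic h₂) h h' with h | h
  · simpa using hunit _ h
  · simpa using hfail _ h

/-! ### Evaluation in environments -/

/-- Composition of evaluation contexts. -/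
def Ctx.comp : Ctx → Ctx → Ctx
  | .hole, F => F
  | .appL E M, F => .appL (E.comp F) M
  | .appR V hV E, F => .appR V hV (E.comp F)
  | .ite E M N, F => .ite (E.comp F) M N
  | .mkref E, F => .mkref (E.comp F)
  | .deref E, F => .deref (E.comp F)
  | .assignL E M, F => .assignL (E.comp F) M
  | .assignR l E, F => .assignR l (E.comp F)

theorem Ctx.fill_comp (E F : Ctx) (M : Term) : (E.comp F).fill M = E.fill (F.fill M) := by
  induction E <;> simp_all [Ctx.comp, Ctx.fill]

/-- In every evaluation context, `M` with store `μ` reduces to `V` with store `μ'`. -/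
def Evals (M : Term) (μ : Store) (V : Term) (μ' : Store) : Prop :=
  ∀ E : Ctx, Relation.ReflTransGen Step (E.fill M, μ) (E.fill V, μ')

namespace Evals

variable {A B M N V W : Term} {μ μ₁ μ₂ μ₃ : Store} {s t : ℕ → Term}

theorem refl (M : Term) (μ : Store) : Evals M μ M μ := fun _ => .refl

theorem trans (h₁ : Evals A μ B μ₁) (h₂ : Evals B μ₁ V μ₂) : Evals A μ V μ₂ :=
  fun E => (h₁ E).trans (h₂ E)

theorem fill (F : Ctx) (h : Evals A μ V μ₁) : Evals (F.fill A) μ (F.fill V) μ₁ := fun E => by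
  simpa only [Ctx.fill_comp] using h (E.comp F)

theorem app (hA : Evals A μ (lam (M.subst (upSubst t))) μ₁) (hB : Evals B μ₁ V μ₂)
    (hV : V.IsValue) (hM : Evals (M.subst (scons V t)) μ₂ W μ₃) :
    Evals (Term.app A B) μ W μ₃ :=
  (hA.fill (.appL .hole B)).trans <|
    (hB.fill (.appR _ (.lam _) .hole)).trans <|
      trans (fun E => .single (.beta E _ _ _ hV)) (by rwa [inst_subst_upSubst])

theorem ite_true (hA : Evals A μ tt μ₁) (hM : Evals M μ₁ V μ₂) :
    Evals (Term.ite A M N) μ V μ₂ :=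
  (hA.fill (.ite .hole M N)).trans <| trans (fun E => .single (.iteTrue E _ _ _)) hM

theorem ite_false (hA : Evals A μ ff μ₁) (hN : Evals N μ₁ V μ₂) :
    Evals (Term.ite A M N) μ V μ₂ :=
  (hA.fill (.ite .hole M N)).trans <| trans (fun E => .single (.iteFalse E _ _ _)) hN

theorem fix (M : Term) (s : ℕ → Term) (μ : Store) :
    Evals ((Term.fix M).subst s) μ
      (lam (M.subst (upSubst (scons ((Term.fix M).subst s) s)))) μ := fun E =>
  .single (by rw [← subst_upSubst_single]; exact .fix E _ μ)

/-- A call of a recursive function. -/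
theorem call_fix (hA : A = (Term.fix M).subst s) (hB : Evals B μ V μ₁) (hV : V.IsValue)
    (h : Evals (M.subst (scons V (scons ((Term.fix M).subst s) s))) μ₁ W μ₂) :
    Evals (Term.app A B) μ W μ₂ :=
  app (hA ▸ fix M s μ) hB hV h

end Evals

/-- `let x = A in B`, where `x` is the variable `0` of `B`. -/
def mlet (A B : Term) : Term := .app (.lam B) A

theorem Evals.mlet {A B V W : Term} {s : ℕ → Term} {μ μ₁ μ₂ : Store}
    (hA : Evals (A.subst s) μ V μ₁) (hV : V.IsValue)
    (hB : Evals (B.subst (scons V s)) μ₁ W μ₂) : Evals ((mlet A B).subst s) μ W μ₂ :=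
  .app (.refl _ _) hA hV hB

/-! ### Counters -/

/-- The type of counters. -/
abbrev Num : Ty := .fn (.base .bool) (.base .bool)

/-- The body of a counter with a cell `1`, the remaining cells being those of the counter `2`:
the first cell whose content is not the argument `0` is set to it; the result tells whether there
is such a cell. -/
def cellBody : Term :=
  .ite (.var 0)
    (.ite (.deref (.var 1)) (.app (.var 2) (.var 0)) (mlet (.assign (.var 1) .tt) .tt))
    (.ite (.deref (.var 1)) (mlet (.assign (.var 1) .ff) .tt) (.app (.var 2) (.var 0)))

/-- The counter with cells at the locations `L`; its content is the number of cells that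
contain `true`. -/
def ctr : List ℕ → Term
  | [] => .lam .ff
  | l :: L => .lam (cellBody.subst (upSubst (scons (.loc l) (scons (ctr L) .var))))

theorem isValue_ctr (L : List ℕ) : (ctr L).IsValue := by
  cases L <;> exact .lam _

/-- The successor of the counter `0`: a new cell is put in front of it. -/
def succBody : Term := mlet (.mkref .tt) (.lam cellBody)

/-- The number of cells of `L` that contain `b`. -/
def cnt (b : Bool) (L : List ℕ) (μ : Store) : ℕ := L.countP fun l => μ[l]? == some b

/-- The content of the counter with cells at `L`. -/
abbrev val (L : List ℕ) (μ : Store) : ℕ := cnt true L μ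

theorem cnt_cons (b : Bool) (l : ℕ) (L : List ℕ) (μ : Store) :
    cnt b (l :: L) μ = cnt b L μ + if μ[l]? = some b then 1 else 0 := by
  simp [cnt, List.countP_cons]

theorem cnt_congr {b : Bool} {L : List ℕ} {μ μ' : Store} (h : ∀ l ∈ L, μ'[l]? = μ[l]?) :
    cnt b L μ' = cnt b L μ :=
  List.countP_congr fun l hl => by rw [h l hl]

theorem cnt_append {b : Bool} {L : List ℕ} {μ : Store} (hL : ∀ l ∈ L, l < μ.length)
    (ν : Store) : cnt b L (μ ++ ν) = cnt b L μ :=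
  cnt_congr fun l hl => List.getElem?_append_left (hL l hl)

theorem cnt_set_of_notMem {b : Bool} {L : List ℕ} {l : ℕ} (hl : l ∉ L) (c : Bool) (μ : Store) :
    cnt b L (μ.set l c) = cnt b L μ :=
  cnt_congr fun k hk => List.getElem?_set_ne <| by rintro rfl; exact hl hk

/-- Without `Nodup` a repeated location would change the count by more than one. -/
theorem cnt_set {b : Bool} {L : List ℕ} {l : ℕ} {μ : Store} (hL : L.Nodup) (hl : l ∈ L)
    (hμ : μ[l]? = some (!b)) :
    cnt b L (μ.set l b) = cnt b L μ + 1 ∧ cnt (!b) L (μ.set l b) + 1 = cnt (!b) L μ := by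
  have hlt : l < μ.length := (List.getElem?_eq_some_iff.1 hμ).1
  induction L with
  | nil => simp at hl
  | cons k L ih =>
    obtain ⟨hk, hL⟩ := List.nodup_cons.1 hL
    simp only [cnt_cons]
    by_cases hkl : l = k
    · subst hkl
      simp [cnt_set_of_notMem hk, hμ, List.getElem?_set_self hlt]
    · have := ih hL (by simpa [hkl] using hl)
      rw [List.getElem?_set_ne hkl]
      omega

/-- Provides the cleared cell that an increment below capacity needs. -/
theorem cnt_add_cnt {L : List ℕ} {μ : Store} (hL : ∀ l ∈ L, l < μ.length) :
    cnt true L μ + cnt false L μ = L.length := by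
  induction L with
  | nil => rfl
  | cons l L ih =>
    have := ih fun k hk => hL k (by simp [hk])
    have hlt := hL l (by simp)
    have hl : μ[l]? = some μ[l] := List.getElem?_eq_getElem hlt
    simp only [cnt_cons, List.length_cons, hl]
    cases μ[l] <;> simp <;> omega

theorem isValue_ofBool (b : Bool) : (ofBool b).IsValue := by cases b <;> constructor

/-- A call of a counter that has a cell to change. -/
theorem evals_ctr_of_pos (b : Bool) {L : List ℕ} {μ : Store} (hL : ∀ l ∈ L, l < μ.length)
    (h : 0 < cnt (!b) L μ) :
    ∃ l ∈ L, μ[l]? = some (!b) ∧ Evals (.app (ctr L) (ofBool b)) μ .tt (μ.set l b) := by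
  induction L with
  | nil => simp [cnt] at h
  | cons l L ih =>
    have hlt := hL l (by simp)
    have hl : μ[l]? = some μ[l] := List.getElem?_eq_getElem hlt
    have hde : Evals (.deref (.loc l)) μ (ofBool μ[l]) μ := fun E => .single (.deref E _ _ _ hl)
    have has : Evals (.assign (.loc l) (ofBool b)) μ .unit (μ.set l b) :=
      fun E => .single (.assign E _ _ _ hlt)
    by_cases hb : μ[l] = !b
    · refine ⟨l, by simp, by rw [hl, hb], .app (.refl _ _) (.refl _ _) (isValue_ofBool b) ?_⟩
      rw [hb] at hde
      cases b
      · exact .ite_false (.refl _ _) (.ite_true hde (.mlet has .unit (.refl _ _)))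
      · exact .ite_true (.refl _ _) (.ite_false hde (.mlet has .unit (.refl _ _)))
    · have hb' : μ[l] = b := by revert hb; cases μ[l] <;> cases b <;> simp
      rw [cnt_cons, hl, if_neg (by simpa using hb), add_zero] at h
      obtain ⟨k, hk, hμ, he⟩ := ih (fun k hk => hL k (by simp [hk])) h
      refine ⟨k, by simp [hk], hμ, .app (.refl _ _) (.refl _ _) (isValue_ofBool b) ?_⟩
      rw [hb'] at hde
      cases b
      · exact .ite_false (.refl _ _) (.ite_false hde he)
      · exact .ite_true (.refl _ _) (.ite_true hde he)

/-- A call of a counter that has no cell to change. -/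
theorem evals_ctr_of_zero (b : Bool) {L : List ℕ} {μ : Store} (hL : ∀ l ∈ L, l < μ.length)
    (h : cnt (!b) L μ = 0) : Evals (.app (ctr L) (ofBool b)) μ .ff μ := by
  induction L with
  | nil => exact .app (t := .var) (M := .ff) (.refl _ _) (.refl _ _) (isValue_ofBool b) (.refl _ _)
  | cons l L ih =>
    have hlt := hL l (by simp)
    have hl : μ[l]? = some μ[l] := List.getElem?_eq_getElem hlt
    have hde : Evals (.deref (.loc l)) μ (ofBool μ[l]) μ := fun E => .single (.deref E _ _ _ hl)
    rw [cnt_cons, hl] at h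
    have hb : μ[l] = b := by revert h; cases μ[l] <;> cases b <;> simp
    have he := ih (fun k hk => hL k (by simp [hk])) (by omega)
    refine .app (.refl _ _) (.refl _ _) (isValue_ofBool b) ?_
    rw [hb] at hde
    cases b
    · exact .ite_false (.refl _ _) (.ite_false hde he)
    · exact .ite_true (.refl _ _) (.ite_true hde he)

theorem evals_succBody {s : ℕ → Term} {L : List ℕ} (h : s 0 = ctr L) (μ : Store) :
    Evals (succBody.subst s) μ (ctr (μ.length :: L)) (μ ++ [true]) := by
  refine .mlet (V := .loc μ.length) (fun E => .single (.mkref E true μ)) (.loc _) ?_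
  have : (Term.lam cellBody).subst (scons (.loc μ.length) s) = ctr (μ.length :: L) := by
    simp [cellBody, BPCFR.mlet, Term.subst, upSubst, ctr, Term.rename, h]
  rw [this]
  exact .refl _ _

theorem val_succ {L : List ℕ} {μ : Store} (hL : ∀ l ∈ L, l < μ.length) :
    val (μ.length :: L) (μ ++ [true]) = val L μ + 1 := by
  simp [val, cnt_cons, cnt_append hL]

theorem HasType.mlet {Γ : List Ty} {A B : Term} {σ τ : Ty} (hA : HasType Γ A σ)
    (hB : HasType (σ :: Γ) B τ) : HasType Γ (mlet A B) τ :=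
  .app (.lam hB) hA

theorem hasType_succBody (Γ : List Ty) : HasType (Num :: Γ) succBody Num := by
  refine .mlet (.mkref .tt) (.lam ?_)
  have h0 : ∀ Δ : List Ty, HasType (.base .bool :: Δ) (.var 0) (.base .bool) := fun _ => .var rfl
  have h1 : HasType (.base .bool :: .refBool :: Num :: Γ) (.var 1) .refBool := .var rfl
  have h2 : HasType (.base .bool :: .refBool :: Num :: Γ) (.var 2) Num := .var rfl
  exact .ite (h0 _) (.ite (.deref h1) (.app h2 (h0 _)) (.mlet (.assign h1 .tt) .tt))
    (.ite (.deref h1) (.mlet (.assign h1 .ff) .tt) (.app h2 (h0 _)))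

/-! ### Implementing functions on numbers -/

variable {ι κ : Type}

/-- The counters with cells at `L i` have the contents `v i` and do not share cells;
all cells are below `N`. -/
structure World (N : ℕ) (L : ι → List ℕ) (μ : Store) (v : ι → ℕ) : Prop where
  nodup : ∀ i, (L i).Nodup
  lt : ∀ i, ∀ l ∈ L i, l < N
  le : N ≤ μ.length
  disjoint : ∀ i j, i ≠ j → (L i).Disjoint (L j)
  val_eq : ∀ i, val (L i) μ = v i

/-- The counter with cells at `R` is allocated, with all cells from `N` upwards. -/
structure Fresh (N : ℕ) (R : List ℕ) (μ : Store) : Prop where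
  nodup : R.Nodup
  le : ∀ l ∈ R, N ≤ l
  lt : ∀ l ∈ R, l < μ.length

/-- Passing from `μ` to `μ'` preserves the contents of the counters `L i`, and of every counter
with cells below `N` that shares no cell with these. -/
structure Preserves (N : ℕ) (L : ι → List ℕ) (μ μ' : Store) : Prop where
  length_le : μ.length ≤ μ'.length
  val_eq : ∀ K : List ℕ, (∀ l ∈ K, l < N) → (∀ i, K = L i ∨ K.Disjoint (L i)) →
    val K μ' = val K μ

/-- `M` evaluates to a fresh counter with content `y`. -/
def Returns (N : ℕ) (L : ι → List ℕ) (M : Term) (μ : Store) (y : ℕ) : Prop :=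
  ∃ R μ', Evals M μ (ctr R) μ' ∧ Fresh N R μ' ∧ val R μ' = y ∧ Preserves N L μ μ'

variable {N N' : ℕ} {L : ι → List ℕ} {R : List ℕ} {μ μ₁ μ₂ : Store} {v : ι → ℕ}

theorem Preserves.trans (h₁ : Preserves N L μ μ₁) (h₂ : Preserves N L μ₁ μ₂) :
    Preserves N L μ μ₂ :=
  ⟨h₁.length_le.trans h₂.length_le, fun K hK h => (h₂.val_eq K hK h).trans (h₁.val_eq K hK h)⟩

theorem Preserves.refl (N : ℕ) (L : ι → List ℕ) (μ : Store) : Preserves N L μ μ :=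
  ⟨le_rfl, fun _ _ _ => rfl⟩

theorem Preserves.lower (h : Preserves N L μ μ₁) (hN : N' ≤ N) : Preserves N' L μ μ₁ :=
  ⟨h.length_le, fun K hK => h.val_eq K fun l hl => (hK l hl).trans_le hN⟩

theorem Preserves.append (h : N ≤ μ.length) (ν : Store) : Preserves N L μ (μ ++ ν) :=
  ⟨by simp, fun _ hK _ => cnt_append (fun l hl => (hK l hl).trans_le h) ν⟩

theorem Preserves.reindex {π : κ → ι} (h : Preserves N (L ∘ π) μ μ₁) : Preserves N L μ μ₁ :=
  ⟨h.length_le, fun K hK hd => h.val_eq K hK fun k => hd (π k)⟩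

theorem World.reindex {π : κ → ι} (hπ : π.Injective) (h : World N L μ v) :
    World N (L ∘ π) μ (v ∘ π) :=
  ⟨fun _ => h.nodup _, fun _ => h.lt _, h.le, fun _ _ hij => h.disjoint _ _ (hπ.ne hij),
    fun _ => h.val_eq _⟩

theorem World.preserve (h : World N L μ v) (hp : Preserves N L μ μ₁) : World N L μ₁ v :=
  ⟨h.nodup, h.lt, h.le.trans hp.length_le, h.disjoint, fun i =>
    (hp.val_eq _ (h.lt i) fun j => by
      by_cases hij : i = j
      · exact .inl (by rw [hij])
      · exact .inr (h.disjoint i j hij)).trans (h.val_eq i)⟩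

theorem World.raise (h : World N L μ v) (hN : N ≤ N') (hμ : N' ≤ μ.length) : World N' L μ v :=
  ⟨h.nodup, fun i l hl => (h.lt i l hl).trans_le hN, hμ, h.disjoint, h.val_eq⟩

theorem Fresh.mono (h : Fresh N R μ) (hμ : μ.length ≤ μ₁.length) : Fresh N R μ₁ :=
  ⟨h.nodup, h.le, fun l hl => (h.lt l hl).trans_le hμ⟩

theorem Fresh.lower (h : Fresh N R μ) (hN : N' ≤ N) : Fresh N' R μ :=
  ⟨h.nodup, fun l hl => hN.trans (h.le l hl), h.lt⟩

theorem Fresh.disjoint {K : List ℕ} (h : Fresh N R μ) (hK : ∀ l ∈ K, l < N) : K.Disjoint R :=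
  fun l hK' hR => absurd (hK l hK') (h.le l hR).not_gt

/-- Turns an intermediate result into a further argument, at index `none`. Its cells lie at or above
`N`, hence apart from the old ones; the bound rises to the whole store to cover them. -/
theorem World.cons (h : World N L μ v) (hR : Fresh N R μ) :
    World μ.length (fun o : Option ι => o.elim R L) μ (fun o => o.elim (val R μ) v) where
  nodup := by rintro (_ | i); exacts [hR.nodup, h.nodup i]
  lt := by
    rintro (_ | i)
    exacts [hR.lt, fun l hl => (h.lt i l hl).trans_le h.le]
  le := le_rfl
  disjoint := by
    rintro (_ | i) (_ | j) hij
    · exact absurd rfl hij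
    · exact (hR.disjoint (h.lt j)).symm
    · exact hR.disjoint (h.lt i)
    · exact h.disjoint i j (by simpa using hij)
  val_eq := by rintro (_ | i); exacts [rfl, h.val_eq i]

/-- Forgets the intermediate result again: a counter living below `N` cannot meet its fresh cells.
-/
theorem Preserves.of_cons (hR : Fresh N R μ) (hN : N ≤ N')
    (hp : Preserves N' (fun o : Option ι => o.elim R L) μ μ₁) : Preserves N L μ μ₁ :=
  ⟨hp.length_le, fun K hK hd => hp.val_eq K (fun l hl => (hK l hl).trans_le hN) <| by
    rintro (_ | i)
    exacts [.inr (hR.disjoint hK), hd i]⟩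

theorem Returns.lower {M : Term} {y : ℕ} (h : Returns N L M μ y) (hN : N' ≤ N) :
    Returns N' L M μ y := by
  obtain ⟨R, μ', he, hf, hy, hp⟩ := h
  exact ⟨R, μ', he, hf.lower hN, hy, hp.lower hN⟩

theorem returns_zero (s : ℕ → Term) (N : ℕ) (L : ι → List ℕ) (μ : Store) :
    Returns N L ((Term.lam .ff).subst s) μ 0 :=
  ⟨[], μ, .refl _ _, ⟨.nil, by simp, by simp⟩, rfl, .refl _ _ _⟩

/-- The successor keeps the cells of `R`, so it is fresh only because `R` is. An argument must
therefore be copied before it is passed here. -/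
theorem returns_succBody {s : ℕ → Term} (hs : s 0 = ctr R) (hN : N ≤ μ.length)
    (hR : Fresh N R μ) (L : ι → List ℕ) : Returns N L (succBody.subst s) μ (val R μ + 1) := by
  refine ⟨_, _, evals_succBody hs μ, ⟨List.nodup_cons.2 ⟨fun h => (hR.lt _ h).false, hR.nodup⟩,
    ?_, ?_⟩, val_succ hR.lt, .append hN _⟩
  · simpa using ⟨hN, hR.le⟩
  · simpa using fun l hl => (hR.lt l hl).trans (Nat.lt_succ_self _)

/-! ### Counter operations and the restoring loop. -/

section Operations

variable [DecidableEq ι] {i : ι} {a : ℕ}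

theorem World.set (h : World N L μ v) {b : Bool} {l : ℕ} (hl : l ∈ L i)
    (hμ : val (L i) (μ.set l b) = a) : World N L (μ.set l b) (Function.update v i a) := by
  refine ⟨h.nodup, h.lt, by simpa using h.le, h.disjoint, fun j => ?_⟩
  by_cases hj : j = i
  · subst hj; simpa using hμ
  · rw [Function.update_of_ne hj, ← h.val_eq j]
    exact cnt_set_of_notMem (fun h' => h.disjoint j i hj h' hl) b μ

/-- Decrementing a counter. -/
theorem World.decrement (h : World N L μ (Function.update v i (a + 1))) :
    ∃ μ₁, Evals (.app (ctr (L i)) .ff) μ .tt μ₁ ∧ World N L μ₁ (Function.update v i a) ∧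
      μ₁.length = μ.length ∧ ∀ K : List ℕ, K.Disjoint (L i) → val K μ₁ = val K μ := by
  have hv : cnt true (L i) μ = a + 1 := by simpa using h.val_eq i
  obtain ⟨l, hl, hμ, he⟩ := evals_ctr_of_pos false (L := L i) (μ := μ)
    (fun l hl => (h.lt i l hl).trans_le h.le) (by simp only [Bool.not_false]; omega)
  have hc := (cnt_set (h.nodup i) hl hμ).2
  refine ⟨_, he, ?_, by simp, fun K hK => cnt_set_of_notMem (fun h' => hK h' hl) _ _⟩
  simpa using h.set (a := a) hl (by simp only [Bool.not_false] at hc; simp only [val]; omega)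

/-- Incrementing a counter within its capacity. -/
theorem World.increment (h : World N L μ (Function.update v i a)) (ha : a < (L i).length) :
    ∃ μ₁, Evals (.app (ctr (L i)) .tt) μ .tt μ₁ ∧ World N L μ₁ (Function.update v i (a + 1)) ∧
      μ₁.length = μ.length ∧ ∀ K : List ℕ, K.Disjoint (L i) → val K μ₁ = val K μ := by
  have hv : cnt true (L i) μ = a := by simpa using h.val_eq i
  have hlt : ∀ l ∈ L i, l < μ.length := fun l hl => (h.lt i l hl).trans_le h.le
  have hadd := cnt_add_cnt hlt
  obtain ⟨l, hl, hμ, he⟩ := evals_ctr_of_pos true hlt (by simp only [Bool.not_true]; omega)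
  have hc := (cnt_set (h.nodup i) hl hμ).1
  refine ⟨_, he, ?_, by simp, fun K hK => cnt_set_of_notMem (fun h' => hK h' hl) _ _⟩
  simpa using h.set (a := a + 1) hl (by simp only [val]; omega)

/-- The body of a recursive procedure that counts the counter `x` down to zero, evaluates `F`,
and restores `x` while it applies `G` repeatedly to the result. -/
def loopBody (x : ℕ) (F G : Term) : Term :=
  .ite (.app (.var (x + 2)) .ff)
    (mlet (.app (.var 1) .unit) (mlet G (mlet (.app (.var (x + 4)) .tt) (.var 1)))) F

/-- The environment in which the body of a recursive procedure is evaluated. -/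
abbrev procEnv (M : Term) (s : ℕ → Term) : ℕ → Term :=
  scons .unit (scons ((Term.fix M).subst s) s)

theorem returns_loopBody {x : ℕ} {F G : Term} {s : ℕ → Term} {r : ℕ → ℕ}
    (hs : s x = ctr (L i))
    (hF : ∀ μ, World N L μ (Function.update v i 0) →
      Returns N L (F.subst (procEnv (loopBody x F G) s)) μ (r 0))
    (hG : ∀ a μ R, World N L μ (Function.update v i a) → Fresh N R μ → val R μ = r a →
      Returns N L (G.subst (scons (ctr R) (procEnv (loopBody x F G) s))) μ (r (a + 1)))
    (a : ℕ) (μ : Store) (h : World N L μ (Function.update v i a)) :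
    Returns N L ((loopBody x F G).subst (procEnv (loopBody x F G) s)) μ (r a) := by
  induction a generalizing μ with
  | zero =>
    obtain ⟨R, μ', he, hr⟩ := hF μ h
    refine ⟨R, μ', .ite_false ?_ he, hr⟩
    have := evals_ctr_of_zero false (L := L i) (μ := μ)
      (fun l hl => (h.lt i l hl).trans_le h.le) (by simpa using h.val_eq i)
    rw [← hs] at this
    exact this
  | succ a ih =>
    obtain ⟨μ₁, he₁, hw₁, hlen₁, hK₁⟩ := h.decrement
    obtain ⟨R₂, μ₂, he₂, hf₂, hv₂, hp₂⟩ := ih μ₁ hw₁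
    have hw₂ := hw₁.preserve hp₂
    obtain ⟨R₃, μ₃, he₃, hf₃, hv₃, hp₃⟩ := hG a μ₂ R₂ hw₂ hf₂ hv₂
    -- The counter held `a + 1` before the decrement, so it has room for the restoring increment.
    have ha : a < (L i).length := by
      have : val (L i) μ = a + 1 := by simpa using h.val_eq i
      exact (this ▸ List.countP_le_length : a + 1 ≤ (L i).length)
    obtain ⟨μ₄, he₄, hw₄, hlen₄, hK₄⟩ := (hw₂.preserve hp₃).increment ha
    rw [← hs] at he₁ he₄
    refine ⟨R₃, μ₄, .ite_true he₁ (.mlet (.call_fix rfl (.refl _ _) .unit he₂) (isValue_ctr _)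
      (.mlet he₃ (isValue_ctr _) (.mlet he₄ .tt (.refl _ _)))), hf₃.mono hlen₄.ge, ?_, ?_, ?_⟩
    · rw [hK₄ _ (hf₃.disjoint (h.lt i)).symm, hv₃]
    · exact hlen₁.ge.trans (hp₂.length_le.trans (hp₃.length_le.trans hlen₄.ge))
    · intro K hK hd
      -- The increment may set a different cell from the one cleared, so only the count of `L i` is
      -- restored. This is why `Preserves` excludes counters that overlap `L i` partially.
      rcases hd i with rfl | hi
      · rw [hw₄.val_eq, h.val_eq]
      · rw [hK₄ K hi, hp₃.val_eq K hK hd, hp₂.val_eq K hK hd, hK₁ K hi]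

end Operations

/-- Given counters for the arguments at the variables `ρ i`, the expression `M` computes a counter
for a number that `F` relates to the arguments, and restores the arguments. -/
def Computes (ρ : ι → ℕ) (M : Term) (F : (ι → ℕ) → ℕ → Prop) : Prop :=
  ∀ (s : ℕ → Term) (μ : Store) (L : ι → List ℕ) (v : ι → ℕ) (y : ℕ),
    (∀ i, s (ρ i) = ctr (L i)) → World μ.length L μ v → F v y →
      Returns μ.length L (M.subst s) μ y

/-- The partial function with graph `F` is computed by some expression. -/
def Implementable (F : (ι → ℕ) → ℕ → Prop) : Prop :=
  ∀ ρ : ι → ℕ, ∃ M : Term,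
    (∀ Γ : List Ty, (∀ i, Γ[ρ i]? = some Num) → HasType Γ M Num) ∧ Computes ρ M F

/-! ### Closure of implementability under the recursion schemes. -/

namespace Implementable

/-- `Computes` constrains a term only where the graph has a value and never asks for divergence, so
the graph may shrink. -/
theorem mono {F G : (ι → ℕ) → ℕ → Prop} (hF : Implementable F) (h : ∀ v y, G v y → F v y) :
    Implementable G := fun ρ => by
  obtain ⟨M, hM, hc⟩ := hF ρ
  exact ⟨M, hM, fun s μ L v y hs hw hy => hc s μ L v y hs hw (h v y hy)⟩

/-- Injectivity keeps distinct arguments from sharing cells. -/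
theorem reindex {π : κ → ι} (hπ : π.Injective) {F : (κ → ℕ) → ℕ → Prop} (hF : Implementable F) :
    Implementable fun (v : ι → ℕ) y => F (v ∘ π) y := fun ρ => by
  obtain ⟨M, hM, hc⟩ := hF (ρ ∘ π)
  refine ⟨M, fun Γ hΓ => hM Γ fun k => hΓ (π k), fun s μ L v y hs hw hy => ?_⟩
  obtain ⟨R, μ', he, hf, hv, hp⟩ :=
    hc s μ (L ∘ π) (v ∘ π) y (fun k => hs (π k)) (hw.reindex hπ) hy
  exact ⟨R, μ', he, hf, hv, hp.reindex⟩

theorem zero : Implementable fun (_ : ι → ℕ) y => y = 0 := fun ρ => by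
  refine ⟨.lam .ff, fun _ _ => .lam .ff, ?_⟩
  rintro s μ L v y - - rfl
  exact returns_zero s _ L μ

/-- Returning the variable itself would alias the argument; the loop with base zero and step
successor makes a copy on fresh cells. -/
theorem proj (i : ι) : Implementable fun (v : ι → ℕ) y => y = v i := fun ρ => by
  classical
  refine ⟨.app (.fix (loopBody (ρ i) (.lam .ff) succBody)) .unit, fun Γ hΓ => ?_, ?_⟩
  · refine .app (τ₁ := .base .unit) (.fix (.ite (.app (.var (hΓ i)) .ff) ?_ (.lam .ff))) .unit
    exact .mlet (.app (.var rfl) .unit) (.mlet (hasType_succBody _)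
      (.mlet (.app (.var (hΓ i)) .tt) (.var rfl)))
  · rintro s μ L v y hs hw rfl
    obtain ⟨R, μ', he, hr⟩ := returns_loopBody (v := v) (r := id) (hs i)
      (fun μ' _ => returns_zero _ _ L μ')
      (fun a μ' R hw' hR ha => ha ▸ returns_succBody rfl hw'.le hR L) (v i) μ (by simpa using hw)
    exact ⟨R, μ', .call_fix rfl (.refl _ _) .unit he, hr⟩

theorem cut {F : (ι → ℕ) → ℕ → Prop} {G : (Option ι → ℕ) → ℕ → Prop} (hF : Implementable F)
    (hG : Implementable G) :
    Implementable fun v y => ∃ a, F v a ∧ G (fun o => o.elim a v) y := fun ρ => by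
  obtain ⟨A, hA, hcA⟩ := hF ρ
  obtain ⟨B, hB, hcB⟩ := hG fun o => o.elim 0 fun i => ρ i + 1
  refine ⟨mlet A B, fun Γ hΓ => .mlet (hA Γ hΓ) (hB _ ?_), ?_⟩
  · rintro (_ | i)
    exacts [rfl, hΓ i]
  · rintro s μ L v y hs hw ⟨a, ha, hy⟩
    obtain ⟨R, μ₁, he₁, hf₁, rfl, hp₁⟩ := hcA s μ L v a hs hw ha
    have hw₁ := hw.preserve hp₁
    obtain ⟨R₂, μ₂, he₂, hf₂, hv₂, hp₂⟩ := hcB (scons (ctr R) s) μ₁ _ _ y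
      (by rintro (_ | i); exacts [rfl, hs i]) (hw₁.cons hf₁) hy
    exact ⟨R₂, μ₂, .mlet he₁ (isValue_ctr _) he₂, hf₂.lower hp₁.length_le, hv₂,
      hp₁.trans (hp₂.of_cons hf₁ hp₁.length_le)⟩

theorem succ (i : ι) : Implementable fun (v : ι → ℕ) y => y = v i + 1 := fun ρ => by
  obtain ⟨A, hA, hcA⟩ := proj i ρ
  refine ⟨mlet A succBody, fun Γ hΓ => .mlet (hA Γ hΓ) (hasType_succBody Γ), ?_⟩
  rintro s μ L v y hs hw rfl
  obtain ⟨R, μ₁, he₁, hf₁, hv₁, hp₁⟩ := hcA s μ L v _ hs hw rfl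
  obtain ⟨R₂, μ₂, he₂, hf₂, hv₂, hp₂⟩ :=
    returns_succBody (s := scons (ctr R) s) rfl (hw.preserve hp₁).le hf₁ L
  exact ⟨R₂, μ₂, .mlet he₁ (isValue_ctr _) he₂, hf₂, by rw [hv₂, hv₁], hp₁.trans hp₂⟩

/-- Iterates `cut`, binding one inner value at a time while the original arguments stay available.
-/
theorem comp {m : ℕ} {F : (ι ⊕ Fin m → ℕ) → ℕ → Prop} {G : Fin m → (ι → ℕ) → ℕ → Prop}
    (hF : Implementable F) (hG : ∀ k, Implementable (G k)) :
    Implementable fun v y => ∃ w : Fin m → ℕ, (∀ k, G k v (w k)) ∧ F (Sum.elim v w) y := by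
  induction m generalizing ι with
  | zero =>
    refine (hF.reindex (Equiv.sumEmpty ι (Fin 0)).injective).mono ?_
    rintro v y ⟨w, -, h⟩
    convert h using 1
    funext x
    rcases x with x | x
    · rfl
    · exact x.elim0
  | succ m ih =>
    let π : ι ⊕ Fin (m + 1) → Option ι ⊕ Fin m :=
      Sum.elim (fun i => .inl (some i)) (Fin.cons (.inl none) .inr)
    have hπ : π.Injective := by
      rintro (i | k) (j | l)
      · simp [π]
      · refine Fin.cases ?_ (fun l => ?_) l <;> simp [π]
      · refine Fin.cases ?_ (fun k => ?_) k <;> simp [π]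
      · refine Fin.cases ?_ (fun k => ?_) k <;> refine Fin.cases ?_ (fun l => ?_) l <;> simp [π]
    refine (cut (hG 0) (ih (hF.reindex hπ)
      fun k => (hG k.succ).reindex (Option.some_injective ι))).mono ?_
    rintro v y ⟨w, hw, hy⟩
    refine ⟨w 0, hw 0, fun k => w k.succ, fun k => hw k.succ, ?_⟩
    convert hy using 1
    funext x
    rcases x with i | k
    · rfl
    · refine Fin.cases ?_ (fun k => ?_) k <;> rfl

theorem prec {f : (ι → ℕ) → ℕ} {g : (Option (Option ι) → ℕ) → ℕ}
    (hf : Implementable fun v y => y = f v) (hg : Implementable fun v y => y = g v) :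
    Implementable fun (v : Option ι → ℕ) y =>
      y = (v none).rec (f (v ∘ some)) fun a r =>
        g fun o => o.elim r fun o => o.elim a (v ∘ some) := fun ρ => by
  classical
  obtain ⟨F, hF, hcF⟩ := hf fun i => ρ (some i) + 2
  obtain ⟨G, hG, hcG⟩ := hg fun o => o.elim 0 fun o => ρ o + 3
  refine ⟨.app (.fix (loopBody (ρ none) F G)) .unit, fun Γ hΓ => ?_, ?_⟩
  · refine .app (τ₁ := .base .unit) (.fix (.ite (.app (.var (hΓ none)) .ff) ?_
      (hF _ fun i => hΓ (some i)))) .unit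
    refine .mlet (.app (.var rfl) .unit) (.mlet (hG _ ?_)
      (.mlet (.app (.var (hΓ none)) .tt) (.var rfl)))
    rintro (_ | o)
    exacts [rfl, hΓ o]
  · rintro s μ L v y hs hw rfl
    let r : ℕ → ℕ := fun a => a.rec (f (v ∘ some)) fun a r =>
      g fun o => o.elim r fun o => o.elim a (v ∘ some)
    have h0 (t : ℕ → Term) (ht : ∀ i, t (ρ (some i) + 2) = ctr (L (some i))) (μ' : Store)
        (hw' : World μ.length L μ' (Function.update v none 0)) :
        Returns μ.length L (F.subst t) μ' (r 0) := by
      have hw'' := (hw'.raise hw'.le le_rfl).reindex (Option.some_injective ι)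
      obtain ⟨R, μ₁, he, hf, hv, hp⟩ := hcF t μ' _ _ _ ht hw'' rfl
      exact Returns.lower ⟨R, μ₁, he, hf, hv, hp.reindex⟩ hw'.le
    have h1 (t : ℕ → Term) (ht : ∀ o, t (ρ o + 2) = ctr (L o)) (a : ℕ) (μ' : Store) (R : List ℕ)
        (hw' : World μ.length L μ' (Function.update v none a)) (hR : Fresh μ.length R μ')
        (ha : val R μ' = r a) :
        Returns μ.length L (G.subst (scons (ctr R) t)) μ' (r (a + 1)) := by
      -- On the way back up the recursion counter holds exactly `a`, so it serves directly as the
      -- index argument of `G`.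
      obtain ⟨R', μ₁, he, hf, hv, hp⟩ := hcG (scons (ctr R) t) μ' _ _ _
        (by rintro (_ | o); exacts [rfl, ht o]) (hw'.cons hR) rfl
      refine ⟨R', μ₁, he, hf.lower hw'.le, ?_, hp.of_cons hR hw'.le⟩
      rw [hv, ha]
      refine congrArg g (funext ?_)
      rintro (_ | _ | i) <;> simp [r]
    obtain ⟨R, μ', he, hr⟩ := returns_loopBody (v := v) (r := r) (hs none)
      (h0 _ fun i => hs (some i)) (h1 _ hs) (v none) μ (by simpa using hw)
    exact ⟨R, μ', .call_fix rfl (.refl _ _) .unit he, hr⟩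

/-- The candidate is passed as an argument of the recursion. Its successor may reuse its cells,
since the old candidate is then dropped. -/
theorem rfind {f : (Option ι → ℕ) → ℕ} (hf : Implementable fun v y => y = f v) :
    Implementable fun (v : ι → ℕ) y => f (fun o => o.elim y v) = 0 ∧
      ∀ k < y, f (fun o => o.elim k v) ≠ 0 := fun ρ => by
  obtain ⟨T, hT, hcT⟩ := hf fun o => o.elim 0 fun i => ρ i + 2
  let body : Term := mlet T
    (.ite (.app (.var 0) .ff) (.app (.var 2) (mlet (.var 1) succBody)) (.var 1))
  refine ⟨.app (.fix body) (.lam .ff), fun Γ hΓ => ?_, ?_⟩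
  · refine .app (τ₁ := Num) (.fix (.mlet (hT _ ?_) (.ite (.app (.var rfl) .ff)
      (.app (.var rfl) (.mlet (.var rfl) (hasType_succBody _))) (.var rfl)))) (.lam .ff)
    rintro (_ | i)
    exacts [rfl, hΓ i]
  rintro s μ L v y hs hw ⟨hy, hlt⟩
  -- Induction on the distance `d` from the candidate `k` to the least zero `y`.
  have key : ∀ d k μ₁ R, k + d = y → World μ.length L μ₁ v → Fresh μ.length R μ₁ →
      val R μ₁ = k → Returns μ.length L
        (body.subst (scons (ctr R) (scons ((Term.fix body).subst s) s))) μ₁ y := by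
    intro d
    induction d with
    | zero =>
      rintro k μ₁ R hk hw₁ hR hv
      obtain ⟨R₂, μ₂, he, hf, hv₂, hp⟩ := hcT (scons (ctr R) (scons ((Term.fix body).subst s) s))
        μ₁ _ _ _ (by rintro (_ | i); exacts [rfl, hs i]) (hw₁.cons hR) rfl
      have hw₂ := (hw₁.cons hR).preserve hp
      rw [hv, show k = y from hk, hy] at hv₂
      refine ⟨R, μ₂, .mlet he (isValue_ctr _) (.ite_false (evals_ctr_of_zero false hf.lt hv₂)
        (.refl _ _)), hR.mono hp.length_le, ?_, hp.of_cons hR hw₁.le⟩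
      exact (hw₂.val_eq none).trans (hv.trans hk)
    | succ d ih =>
      rintro k μ₁ R hk hw₁ hR hv
      obtain ⟨R₂, μ₂, he, hf, hv₂, hp⟩ := hcT (scons (ctr R) (scons ((Term.fix body).subst s) s))
        μ₁ _ _ _ (by rintro (_ | i); exacts [rfl, hs i]) (hw₁.cons hR) rfl
      have hw₂ := (hw₁.cons hR).preserve hp
      have hpos : 0 < val R₂ μ₂ := by
        rw [hv₂, hv]; exact Nat.pos_of_ne_zero (hlt k (by omega))
      obtain ⟨l, hl, -, he₂⟩ := evals_ctr_of_pos false hf.lt hpos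
      -- The zero test is destructive, but it alters only a cell allocated while evaluating `T`.
      have hK : ∀ K : List ℕ, (∀ l ∈ K, l < μ₁.length) → val K (μ₂.set l false) = val K μ₂ :=
        fun K hK => cnt_set_of_notMem (fun h => (hK l h).not_ge (hf.le l hl)) _ _
      have hp₂ : Preserves μ.length L μ₁ (μ₂.set l false) := by
        have := hp.of_cons hR hw₁.le
        exact ⟨by simpa using this.length_le, fun K hK' hd =>
          (hK K fun l hl => (hK' l hl).trans_le hw₁.le).trans (this.val_eq K hK' hd)⟩
      have hR₂ := hR.mono hp₂.length_le
      have hvR : val R (μ₂.set l false) = k :=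
        (hK R hR.lt).trans ((hw₂.val_eq none).trans hv)
      have hw₃ := hw₁.preserve hp₂
      obtain ⟨R₃, μ₃, he₃, hf₃, hv₃, hp₃⟩ :=
        returns_succBody (s := scons (ctr R) (scons (ctr R₂) (scons (ctr R)
          (scons ((Term.fix body).subst s) s)))) rfl hw₃.le hR₂ L
      obtain ⟨R₄, μ₄, he₄, hf₄, hv₄, hp₄⟩ := ih (k + 1) μ₃ R₃ (by omega) (hw₃.preserve hp₃) hf₃
        (by rw [hv₃, hvR])
      exact ⟨R₄, μ₄, .mlet he (isValue_ctr _) (.ite_true he₂ (.call_fix rfl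
        (.mlet (.refl _ _) (isValue_ctr _) he₃) (isValue_ctr _) he₄)), hf₄, hv₄,
        hp₂.trans (hp₃.trans hp₄)⟩
  obtain ⟨R, μ', he, hr⟩ := key y 0 μ [] (by omega) hw ⟨.nil, by simp, by simp⟩ rfl
  exact ⟨R, μ', .call_fix rfl (.refl _ _) (isValue_ctr []) he, hr⟩

end Implementable

/-! ### Partial recursive functions are implementable -/

theorem vector_ofFn_finSuccEquiv {n : ℕ} (a : ℕ) (v : Fin n → ℕ) :
    List.Vector.ofFn (fun i => (finSuccEquiv n i).elim a v) = a ::ᵥ List.Vector.ofFn v := by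
  simp [List.Vector.ofFn]

theorem mem_vector_mOfFn {n : ℕ} {g : Fin n → Part ℕ} {w : List.Vector ℕ n}
    (h : w ∈ List.Vector.mOfFn g) (i : Fin n) : w.get i ∈ g i := by
  induction n with
  | zero => exact i.elim0
  | succ n ih =>
    simp only [List.Vector.mOfFn, Part.bind_eq_bind, Part.mem_bind_iff, Part.pure_eq_some,
      Part.mem_some_iff] at h
    obtain ⟨a, ha, w', hw', rfl⟩ := h
    refine Fin.cases ?_ (fun i => ?_) i
    · simpa using ha
    · simpa using ih hw' i

theorem implementable_of_primrec' {n : ℕ} {f : List.Vector ℕ n → ℕ} (hf : Nat.Primrec' f) :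
    Implementable fun (v : Fin n → ℕ) y => y = f (.ofFn v) := by
  induction hf with
  | zero => exact .zero
  | succ => exact .succ 0
  | get i => simpa using Implementable.proj i
  | @comp m n f g _ _ ihf ihg =>
    refine ((ihf.reindex (ι := Fin m ⊕ Fin n) Sum.inr_injective).comp ihg).mono ?_
    rintro v y rfl
    exact ⟨_, fun k => rfl, rfl⟩
  | @prec n f g _ _ ihf ihg =>
    -- `Nat.Primrec'.prec` lists the index before the previous value, whereas the outer `none` of
    -- `Implementable.prec` is the previous value.
    let π : Fin (n + 2) → Option (Option (Fin n)) :=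
      Fin.cons (some none) (Fin.cons none fun i => some (some i))
    have hπ : π.Injective := by
      simp only [π, Fin.cons_injective_iff, Set.mem_range, not_exists]
      refine ⟨Fin.cases (by simp) (by simp), by simp, fun i j h => by simpa using h⟩
    refine ((ihf.prec (ihg.reindex hπ)).reindex (finSuccEquiv n).symm.injective).mono ?_
    rintro v y rfl
    have h (a r : ℕ) (w : Fin n → ℕ) :
        List.Vector.ofFn ((fun o : Option (Option (Fin n)) => o.elim r fun o => o.elim a w) ∘ π) =
          a ::ᵥ r ::ᵥ List.Vector.ofFn w := rfl
    simp only [h]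
    rfl

theorem implementable_of_partrec' {n : ℕ} {f : List.Vector ℕ n →. ℕ} (hf : Nat.Partrec' f) :
    Implementable fun (v : Fin n → ℕ) y => y ∈ f (.ofFn v) := by
  induction hf with
  | prim hf => simpa using implementable_of_primrec' hf
  | @comp m n f g _ _ ihf ihg =>
    refine ((ihf.reindex (ι := Fin m ⊕ Fin n) Sum.inr_injective).comp ihg).mono ?_
    intro v y hy
    obtain ⟨w, hw, hy⟩ := Part.mem_bind_iff.1 hy
    refine ⟨w.get, mem_vector_mOfFn hw, ?_⟩
    simpa [Function.comp_def] using hy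
  | @rfind n f _ ih =>
    have hf := ih.reindex (finSuccEquiv n).injective
    simp only [PFun.coe_val, Part.mem_some_iff] at hf
    refine hf.rfind.mono ?_
    intro v y hy
    replace hy := Nat.mem_rfind.1 hy
    simpa [Function.comp_def, vector_ofFn_finSuccEquiv] using hy

/-! ### The reduction -/

/-- An expression for the number `n`. -/
def numeral (n : ℕ) : Term := n.rec (.lam .ff) fun _ M => .app (.lam succBody) M

theorem hasType_numeral (n : ℕ) : HasType [] (numeral n) Num := by
  induction n with
  | zero => exact .lam .ff
  | succ n ih => exact .mlet ih (hasType_succBody _)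

theorem Evals.mlet_closed {A B V W : Term} {μ μ₁ μ₂ : Store} (hA : Evals A μ V μ₁)
    (hV : V.IsValue) (hB : Evals (B.subst (scons V .var)) μ₁ W μ₂) :
    Evals (.app (.lam B) A) μ W μ₂ := by
  have h := Evals.mlet (A := A) (s := .var) (by rwa [subst_var]) hV hB
  rwa [subst_var] at h

theorem evals_numeral (n : ℕ) :
    ∃ R μ, Evals (numeral n) [] (ctr R) μ ∧ Fresh 0 R μ ∧ val R μ = n := by
  induction n with
  | zero => exact ⟨[], [], .refl _ _, ⟨.nil, by simp, by simp⟩, rfl⟩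
  | succ n ih =>
    obtain ⟨R, μ, he, hf, hv⟩ := ih
    obtain ⟨R', μ', he', hf', hv', -⟩ := returns_succBody (s := scons (ctr R) .var) rfl
      (Nat.zero_le _) hf (Empty.elim : Empty → List ℕ)
    exact ⟨R', μ', .mlet_closed he (isValue_ctr _) he', hf', by rw [hv', hv]⟩

/-- The expression that computes `P` at the argument `n` and fails if the result is zero. -/
def zeroTest (P : Term) (n : ℕ) : Term :=
  .app (.lam (mlet P (.ite (.app (.var 0) .ff) .unit .fail))) (numeral n)

/-- On codes, applying a fixed term is arithmetic with pairing, and `numeral` iterates it. -/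
theorem computable_zeroTest (P : Term) : Computable (zeroTest P) := by
  have happ (A : Term) : Primrec (Term.app A) := by
    refine ((Primrec.ofNat Term).comp (Primrec.nat_add.comp (Primrec.nat_mul.comp
      (.const 9) (Primrec₂.natPair.comp (.const A.code) Primrec.encode)) (.const 7))).of_eq
      fun B => ofCode_code (.app A B)
  exact ((happ _).comp (Primrec.nat_rec₁ _ ((happ _).comp Primrec.snd).to₂)).to_comp

theorem exists_zeroTest {u : ℕ →. ℕ} (hu : Partrec u) :
    ∃ P : Term, ∀ n, IsInstance (zeroTest P n) ∧ (0 ∈ u n → Reaches (zeroTest P n)) ∧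
      ∀ y, y + 1 ∈ u n → ¬ Reaches (zeroTest P n) := by
  obtain ⟨P, hP, hc⟩ := implementable_of_partrec' (Nat.Partrec'.part_iff₁.2 hu) fun _ => 0
  refine ⟨P, fun n => ?_⟩
  obtain ⟨R, μ, he, hf, hv⟩ := evals_numeral n
  have hrun (y : ℕ) (hy : y ∈ u n) : ∃ R' μ', Evals (P.subst (scons (ctr R) .var)) μ (ctr R') μ' ∧
      Fresh μ.length R' μ' ∧ val R' μ' = y := by
    obtain ⟨R', μ', he', hf', hv', -⟩ := hc (scons (ctr R) .var) μ (fun _ => R) (fun _ => n) y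
      (fun _ => rfl) ⟨fun _ => hf.nodup, fun _ => hf.lt, le_rfl,
        fun i j hij => absurd (Subsingleton.elim i j) hij, fun _ => hv⟩ (by simpa using hy)
    exact ⟨R', μ', he', hf', hv'⟩
  -- Typing does not depend on `u n` being defined, so a decision procedure must answer for every
  -- `n`.
  refine ⟨⟨.unit, .mlet (hasType_numeral n) (.mlet (hP _ fun _ => rfl)
    (.ite (.app (.var rfl) .ff) .unit .fail))⟩, fun hy => ?_, fun y hy => ?_⟩
  · obtain ⟨R', μ', he', hf', hv'⟩ := hrun 0 hy
    exact ⟨μ', Evals.mlet_closed he (isValue_ctr _) (.mlet he' (isValue_ctr _)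
      (B := .ite (.app (.var 0) .ff) .unit .fail)
      (.ite_false (evals_ctr_of_zero false hf'.lt hv') (.refl _ _))) .hole⟩
  · obtain ⟨R', μ', he', hf', hv'⟩ := hrun (y + 1) hy
    obtain ⟨l, -, -, hl⟩ := evals_ctr_of_pos false hf'.lt (hv'.symm ▸ y.succ_pos : 0 < val R' μ')
    exact not_reaches_of_unit (Evals.mlet_closed he (isValue_ctr _) (.mlet he' (isValue_ctr _)
      (B := .ite (.app (.var 0) .ff) .unit .fail) (.ite_true hl (.refl _ _))) .hole)

end BPCFR

theorem mainTheorem4 : ¬ BPCFR.ReachabilityDecidable := by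
  rintro ⟨f, hf, hdec⟩
  have hu : Partrec fun n : ℕ => (Denumerable.ofNat Nat.Partrec.Code n).eval n :=
    Nat.Partrec.Code.eval_part.comp (Computable.ofNat _) Computable.id
  obtain ⟨P, hP⟩ := BPCFR.exists_zeroTest hu
  -- The answer is inverted: a claim of failure gives `1`, for which the test does not fail, and a
  -- denial gives `0`, for which it does.
  have hg : Partrec fun n => (f (BPCFR.zeroTest P n)).map fun b => cond b 1 0 :=
    (hf.comp (BPCFR.computable_zeroTest P)).map
      (Computable.cond Computable.snd (.const 1) (.const 0)).to₂
  obtain ⟨c, hc⟩ := Nat.Partrec.Code.exists_code.1 (Partrec.nat_iff.1 hg)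
  obtain ⟨hI, h0, h1⟩ := hP (Encodable.encode c)
  obtain ⟨a, ha, hiff⟩ := hdec _ hI
  have hmem : cond a 1 0 ∈ c.eval (Encodable.encode c) := by
    rw [hc]; exact Part.mem_map _ ha
  rw [Denumerable.ofNat_encode] at h0 h1
  cases a with
  | false => exact Bool.false_ne_true (hiff.2 (h0 hmem))
  | true => exact h1 0 hmem (hiff.1 rfl)
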